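/- **Setting.** Let $(V,d)$ be a metric space and let $F:[0,\infty)\to(0,\infty)$ be a non-increasing function with $$\|F\|=\sup_{x\in V}\sum_{y\in V}F(d(x,y))<\infty,\qquad C=\sup_{x,y\in V}\sum_{z\in V}\frac{F(d(x,z))\,F(d(z,y))}{F(d(x,y))}<\infty .$$ For $a\ge 0$ put $F_a(r)=e^{-ar}F(r)$, and let $C_a$ be the constant $C$ formed with $F_a$ in place of $F$. To each $x\in V$ attach the Hilbert space $\mathbb C^{n_x}$. For finite $X\subset V$ let $\mathcal A_X=\bigotimes_{x\in X}M_{n_x}(\mathbb C)$ with the operator norm, and identify $A\in\mathcal A_X$ with $A\otimes 1\in\mathcal A_\Lambda$ whenever $X\subset\Lambda$. An interaction $\Phi$ assigns to every finite $X\subset V$ a self-adjoint $\Phi(X)\in\mathcal A_X$. Write $$\|\Phi\|_a=\sup_{x,y\in V}\ \sum_{X\ni x,y}\frac{\|\Phi(X)\|}{F_a(d(x,y))},$$ and $\Phi\in\mathcal B_a(V)$ if $\|\Phi\|_a<\infty$. For finite $\Lambda\subset V$ let $H_\Lambda=\sum_{Z\subset\Lambda}\Phi(Z)$ and $\tau^\Lambda_t(A)=e^{itH_\Lambda}Ae^{-itH_\Lambda}$.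 For finite $X\subset V$ let $S(X)$ be the set of finite $Z\subset V$ that meet both $X$ and $V\setminus X$, and let $\partial_\Phi X$ be the set of $x\in X$ that lie in some $Z\in S(X)$ with $\Phi(Z)\neq0$. For $U\subset V$ let $$\|\Phi\|_a^U(x;X)=\sup_{y\in U}\ \sum_{Z\in S(X):\,x,y\in Z}\frac{\|\Phi(Z)\|}{F_a(d(x,y))}\ \text{ if }x\in X,\qquad \|\Phi\|_a^U(x;X)=0\ \text{ otherwise},$$ $$D_a^U(X,Y)=\min\Big[\sum_{x\in X}\sum_{y\in Y}\|\Phi\|^U_a(x;X)F_a(d(x,y)),\ \sum_{x\in X}\sum_{y\in Y}\|\Phi\|^U_a(y;Y)F_a(d(x,y))\Big].$$ Let $d(X,Y)=\inf_{x\in X,\,y\in Y}d(x,y)$, which is $\infty$ if $X$ or $Y$ is empty. Call $v\in[0,\infty)$ a *velocity bound* for $\Phi$ if there are $\mu>0$ and $K$ such that for all finite $\Lambda\subset V$, all $X,Y\subset\Lambda$ with $d(X,Y)>0$, all $A\in\mathcal A_X$, $B\in\mathcal A_Y$ and all $t\in\mathbb R$, $$\|[\tau^\Lambda_t(A),B]\|\le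 K\,\|A\|\,\|B\|\,\min(|\partial_\Phi X|,|\partial_\Phi Y|)\,e^{-\mu(d(X,Y)-v|t|)},$$ and let $v_\Phi\in[0,\infty]$ be the infimum of all velocity bounds for $\Phi$. (In this bound and in (2) the right-hand side is read as $0$ if $X$ or $Y$ is empty.) **Theorem (Lieb–Robinson bound).** Let $\Phi$ be an interaction. 1. Let $a\ge0$ and $\Phi\in\mathcal B_a(V)$. For every finite $\Lambda\subset V$ and all $X,Y\subset\Lambda$ with $d(X,Y)>0$, one has, for all $A\in\mathcal A_X$, $B\in\mathcal A_Y$ and $t\in\mathbb R$, $$\|[\tau^\Lambda_t(A),B]\|\le\frac{2\|A\|\|B\|}{\|\Phi\|_aC_a}\Big(e^{2\|\Phi\|_aC_a|t|}-1\Big)D^\Lambda_a(X,Y),$$ where the right-hand side is read as $0$ if $\|\Phi\|_aC_a=0$. Moreover $D_a^\Lambda(X,Y)\le D_a^V(X,Y)$, so the bound is uniform in $\Lambda$. 2. Let $a>0$ and $\Phi\in\mathcal B_a(V)$. For $\Lambda,X,Y,A,B,t$ as in 1, $$\|[\tau^\Lambda_t(A),B]\|\le\frac{2\|A\|\|B\|\|F\|}{C_a}\min(|\partial_\Phi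 X|,|\partial_\Phi Y|)\,e^{-a\left[d(X,Y)-\frac{2\|\Phi\|_aC_a}{a}|t|\right]}.$$ 3. The velocity of propagation satisfies $\displaystyle v_\Phi\le\inf_{a>0}\frac{2\|\Phi\|_aC_a}{a}$, where the terms with $\Phi\notin\mathcal B_a(V)$ count as $\infty$. -/

import Mathlib

open scoped Matrix.Norms.L2Operator ENNReal NNReal

noncomputable section

namespace LiebRobinson

section System

variable {V : Type*} [DecidableEq V]

/-! ### Spin systems: local algebras, interactions, finite-volume dynamics -/

/-- The indices of the standard product basis of `⨂_{x ∈ X} ℂ^{n x}`. -/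
abbrev Config (n : V → ℕ) (X : Finset V) : Type _ := (x : X) → Fin (n x)

/-- The algebra of observables `A_X = ⨂_{x ∈ X} M_{n x}` of a finite set `X` of sites, realised as
the matrices acting on `⨂_{x ∈ X} ℂ^{n x}`. The norm is the operator norm for the Hilbert space
norm (the scoped instances `Matrix.Norms.L2Operator`), and `star` is the conjugate transpose. -/
abbrev LocalAlg (n : V → ℕ) (X : Finset V) : Type _ := Matrix (Config n X) (Config n X) ℂ

/-- Restriction of a configuration on `L` to `X ⊆ L`. -/
def Config.restrict {n : V → ℕ} {X L : Finset V} (h : X ⊆ L) (s : Config n L) : Config n X :=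
  fun x => s ⟨x.1, h x.2⟩

/-- The identification of `A_X` with a subalgebra of `A_L` for `X ⊆ L`, namely `A ↦ A ⊗ 1`,
with `1` the identity on the sites of `L \ X`. -/
def embed {n : V → ℕ} {X L : Finset V} (h : X ⊆ L) (A : LocalAlg n X) : LocalAlg n L :=
  Matrix.of fun s s' =>
    if ∀ y : L, y.1 ∉ X → s y = s' y then A (s.restrict h) (s'.restrict h) else 0

/-- An interaction: a self-adjoint `Φ(X) ∈ A_X` for every finite set `X` of sites. -/
structure Interaction (n : V → ℕ) where
  /-- the interaction term of a finite set -/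
  term : (X : Finset V) → LocalAlg n X
  /-- all terms are self-adjoint -/
  selfAdjoint : ∀ X, IsSelfAdjoint (term X)

variable {n : V → ℕ}

/-- The local Hamiltonian `H_L = ∑_{Z ⊆ L} Φ(Z)`. -/
def hamiltonian (Φ : Interaction n) (L : Finset V) : LocalAlg n L :=
  ∑ Z : {Z : Finset V // Z ∈ L.powerset}, embed (Finset.mem_powerset.1 Z.2) (Φ.term Z.1)

/-- The time evolution `τ_t^L(A) = e^{itH_L} A e^{-itH_L}`. -/
def evolve (Φ : Interaction n) (L : Finset V) (t : ℝ) (A : LocalAlg n L) : LocalAlg n L :=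
  NormedSpace.exp ((Complex.I * (t : ℂ)) • hamiltonian Φ L) * A *
    NormedSpace.exp (-((Complex.I * (t : ℂ)) • hamiltonian Φ L))

/-- `[τ_t^L(A), B] ∈ A_L` for `A ∈ A_X`, `B ∈ A_Y` and `X, Y ⊆ L`. -/
def evolvedCommutator (Φ : Interaction n) {L X Y : Finset V} (hX : X ⊆ L) (hY : Y ⊆ L)
    (t : ℝ) (A : LocalAlg n X) (B : LocalAlg n Y) : LocalAlg n L :=
  ⁅evolve Φ L t (embed hX A), embed hY B⁆

/-! ### Surfaces and boundaries -/

/-- The surface `S(X)` of `X` in the whole set of sites: the finite sets that meet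
both `X` and its complement. -/
def surface (X : Finset V) : Set (Finset V) :=
  {Z | (∃ z ∈ Z, z ∈ X) ∧ ∃ z ∈ Z, z ∉ X}

/-- The `Φ`-boundary of `X`: the points of `X` that lie in some `Z ∈ S(X)` with `Φ(Z) ≠ 0`. -/
def boundary (Φ : Interaction n) (X : Finset V) : Set V :=
  {x | x ∈ X ∧ ∃ Z ∈ surface X, x ∈ Z ∧ Φ.term Z ≠ 0}

end System

/-! ### The function `F`, distances, and the norms of an interaction

All suprema and all sums of nonnegative terms are taken in `[0, ∞]`. -/

/-- `‖F‖ = sup_x ∑_y F(d(x,y))`. -/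
def decayNorm (V : Type*) [MetricSpace V] (F : ℝ → ℝ) : ℝ≥0∞ :=
  ⨆ x : V, ∑' y : V, ENNReal.ofReal (F (dist x y))

/-- The convolution constant `C = sup_{x,y} ∑_z F(d(x,z)) F(d(z,y)) / F(d(x,y))`. -/
def convConst (V : Type*) [MetricSpace V] (F : ℝ → ℝ) : ℝ≥0∞ :=
  ⨆ (x : V) (y : V), ∑' z : V, ENNReal.ofReal (F (dist x z) * F (dist z y) / F (dist x y))

/-- `F : [0, ∞) → (0, ∞)` is non-increasing, uniformly integrable over `V`, and has a finite
convolution constant. Only the values of `F` on `[0, ∞)` matter. -/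
structure IsDecayFunction (V : Type*) [MetricSpace V] (F : ℝ → ℝ) : Prop where
  pos : ∀ r, 0 ≤ r → 0 < F r
  antitone : AntitoneOn F (Set.Ici 0)
  decayNorm_lt_top : decayNorm V F < ∞
  convConst_lt_top : convConst V F < ∞

/-- `F_a(r) = e^{-ar} F(r)`. -/
def weighted (F : ℝ → ℝ) (a : ℝ) : ℝ → ℝ := fun r => Real.exp (-a * r) * F r

/-- The distance `d(X, Y)` of two finite sets, `∞` if one of them is empty. -/
def setDist {V : Type*} [MetricSpace V] (X Y : Finset V) : ℝ≥0∞ :=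
  ⨅ x ∈ X, ⨅ y ∈ Y, edist x y

section Norms

variable {V : Type*} [DecidableEq V] [MetricSpace V] {n : V → ℕ}

/-- `‖Φ‖_a = sup_{x,y} ∑_{X ∋ x,y} ‖Φ(X)‖ / F_a(d(x,y))`, the sum over the finite sets `X`. -/
def Interaction.norm (Φ : Interaction n) (F : ℝ → ℝ) (a : ℝ) : ℝ≥0∞ :=
  ⨆ (x : V) (y : V), ∑' Z : {Z : Finset V // x ∈ Z ∧ y ∈ Z},
    ENNReal.ofReal (‖Φ.term Z.1‖ / weighted F a (dist x y))

/-- `Φ ∈ B_a(V)`. -/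
def Interaction.MemB (Φ : Interaction n) (F : ℝ → ℝ) (a : ℝ) : Prop :=
  Φ.norm F a < ∞

/-- `‖Φ‖_a(x; X) = sup_{y ∈ U} ∑_{Z ∈ S(X), x,y ∈ Z} ‖Φ(Z)‖ / F_a(d(x,y))` if `x ∈ X`, and `0`
otherwise. The range `U` of `y` is the finite volume or the set of all sites. -/
def Interaction.surfaceNorm (Φ : Interaction n) (F : ℝ → ℝ) (a : ℝ) (U : Set V) (X : Finset V)
    (x : V) : ℝ≥0∞ :=
  if x ∈ X then
    ⨆ y ∈ U, ∑' Z : {Z : Finset V // Z ∈ surface X ∧ x ∈ Z ∧ y ∈ Z},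
      ENNReal.ofReal (‖Φ.term Z.1‖ / weighted F a (dist x y))
  else 0

/-- `D_a(X, Y)`, the minimum of `∑_{x ∈ X} ∑_{y ∈ Y} ‖Φ‖_a(x; X) F_a(d(x,y))` and
`∑_{x ∈ X} ∑_{y ∈ Y} ‖Φ‖_a(y; Y) F_a(d(x,y))`. -/
def Interaction.surfaceSum (Φ : Interaction n) (F : ℝ → ℝ) (a : ℝ) (U : Set V)
    (X Y : Finset V) : ℝ :=
  min (∑ x ∈ X, ∑ y ∈ Y, (Φ.surfaceNorm F a U X x).toReal * weighted F a (dist x y))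
    (∑ x ∈ X, ∑ y ∈ Y, (Φ.surfaceNorm F a U Y y).toReal * weighted F a (dist x y))

/-! ### Velocity of propagation -/

/-- `v` bounds the speed of propagation: outside the cone `d(X, Y) ≤ v|t|` commutators are
exponentially small in `d(X, Y) - v|t|`, with a decay rate `μ` and a constant `K` that depend
neither on the volume `L`, nor on the observables and their supports, nor on `t`. The size of the
boundaries of the supports enters as a prefactor. -/
def Interaction.IsVelocityBound (Φ : Interaction n) (v : ℝ≥0) : Prop :=
  ∃ μ : ℝ, 0 < μ ∧ ∃ K : ℝ, ∀ (L X Y : Finset V) (hX : X ⊆ L) (hY : Y ⊆ L), 0 < setDist X Y →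
    ∀ (A : LocalAlg n X) (B : LocalAlg n Y) (t : ℝ),
      ‖evolvedCommutator Φ hX hY t A B‖ ≤
        K * ‖A‖ * ‖B‖ * (min (boundary Φ X).ncard (boundary Φ Y).ncard : ℕ) *
          Real.exp (-μ * ((setDist X Y).toReal - v * |t|))

/-- The velocity `v_Φ` of propagation: the infimum of all bounds on the speed of propagation,
`∞` if there are none. -/
def Interaction.velocity (Φ : Interaction n) : ℝ≥0∞ :=
  ⨅ (v : ℝ≥0) (_ : Φ.IsVelocityBound v), (v : ℝ≥0∞)

end Norms

end LiebRobinson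

end

open LiebRobinson

/-! Fix `B` supported in `Y` and split `H_L = K + S`, where `S` collects the terms in the surface of
`X`. The evolution under `K` keeps `A` inside `X`, so for disjoint `X` and `Y` it creates no
commutator with `B`. Comparing the two dynamics (`norm_lie_evolve_le`) gives, for `t ≥ 0`, that
`‖[τ_t(A), B]‖` is at most `2‖A‖‖B‖` if `X` meets `Y` and `0` otherwise, plus `2‖A‖ ∑_Z ∫_0^t
‖[τ_s(Φ(Z)), B]‖ ds` over the sets `Z` crossing the surface of `X`. The commutators on the right are
of the same kind, so the estimate can be iterated.

The iteration closes on any weight `D` that dominates the surface terms meeting `Y` and satisfies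
`∑_Z ‖Φ(Z)‖ D(Z) ≤ κ D(X)`. Induction (`norm_evolvedCommutator_le_iterate`) then produces `(e^{2κt}
- 1)/κ · D(X)` and a remainder `(2Nt)^k / k!`, which vanishes as `k → ∞` because the volume is
finite. The weight used is one half of the minimum defining `D_a^L`. The convolution property of
`F_a` yields the second condition with `κ = ‖Φ‖_a C_a`
(`Interaction.sum_surface_halfSurfaceSum_le`).

The other half of the minimum comes from exchanging `A` and `B`, and negative times from replacing
`Φ` by `-Φ`. Since only boundary points contribute to the weight and `F_a(d(x,y)) ≤ e^{-a d(X,Y)}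
F(d(x,y))`, the cone bound follows, with the velocity read off from its exponent. -/

namespace LiebRobinson

/-! ### One-parameter unitary groups in a C⋆-algebra -/

section CStar

variable {𝔸 : Type*} [CStarAlgebra 𝔸]

/-- The unitary group `e^{itH}` generated by `H`. -/
noncomputable def phase (H : 𝔸) (t : ℝ) : 𝔸 := NormedSpace.exp ((Complex.I * (t : ℂ)) • H)

lemma phase_zero (H : 𝔸) : phase H 0 = 1 := by simp [phase]

lemma exp_neg_eq_phase (H : 𝔸) (t : ℝ) :
    NormedSpace.exp (-((Complex.I * (t : ℂ)) • H)) = phase H (-t) := by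
  simp [phase]

lemma phase_neg_left (H : 𝔸) (t : ℝ) : phase (-H) t = phase H (-t) := by
  simp [phase]

lemma phase_mul_phase_neg (H : 𝔸) (t : ℝ) : phase H t * phase H (-t) = 1 := by
  let _ : NormedAlgebra ℚ 𝔸 := NormedAlgebra.restrictScalars ℚ ℂ 𝔸
  rw [phase, phase, ← NormedSpace.exp_add_of_commute]
  · simp
  · exact ((Commute.refl H).smul_right _).smul_left _

lemma phase_neg_mul_phase (H : 𝔸) (t : ℝ) : phase H (-t) * phase H t = 1 := by
  simpa using phase_mul_phase_neg H (-t)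

lemma phase_mul_phase_neg_assoc (H : 𝔸) (t : ℝ) (M : 𝔸) : phase H t * (phase H (-t) * M) = M := by
  rw [← mul_assoc, phase_mul_phase_neg, one_mul]

lemma phase_neg_mul_phase_assoc (H : 𝔸) (t : ℝ) (M : 𝔸) : phase H (-t) * (phase H t * M) = M := by
  rw [← mul_assoc, phase_neg_mul_phase, one_mul]

lemma phase_mem_unitary {H : 𝔸} (hH : IsSelfAdjoint H) (t : ℝ) : phase H t ∈ unitary 𝔸 := by
  let _ : NormedAlgebra ℚ 𝔸 := NormedAlgebra.restrictScalars ℚ ℂ 𝔸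
  refine NormedSpace.exp_mem_unitary_of_mem_skewAdjoint ?_
  rw [skewAdjoint.mem_iff]
  simp [hH.star_eq]

lemma commute_phase {H M : 𝔸} (h : Commute M H) (t : ℝ) : Commute M (phase H t) :=
  (h.smul_right _).exp_right

lemma hasDerivAt_phase (H : 𝔸) (t : ℝ) :
    HasDerivAt (phase H) (phase H t * (Complex.I • H)) t := by
  have h := (hasDerivAt_exp_smul_const (𝕂 := ℝ) (Complex.I • H) t)
  have e : phase H = fun u : ℝ => NormedSpace.exp (u • (Complex.I • H)) := by
    ext u
    rw [phase, mul_comm, mul_smul]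
    rfl
  rw [e]
  exact h

lemma hasDerivAt_phase_neg (H : 𝔸) (t : ℝ) :
    HasDerivAt (fun s => phase H (-s)) (-(phase H (-t) * (Complex.I • H))) t := by
  have e : (fun s => phase H (-s)) = phase (-H) := funext fun s => (phase_neg_left H s).symm
  rw [e]
  simpa [phase_neg_left] using hasDerivAt_phase (-H) t

lemma norm_phase_conj {H : 𝔸} (hH : IsSelfAdjoint H) (t : ℝ) (M : 𝔸) :
    ‖phase H t * M * phase H (-t)‖ = ‖M‖ := by
  rw [CStarRing.norm_mul_mem_unitary _ (phase_mem_unitary hH _),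
    CStarRing.norm_mem_unitary_mul _ (phase_mem_unitary hH _)]

lemma norm_lie_le (M N : 𝔸) : ‖⁅M, N⁆‖ ≤ 2 * ‖M‖ * ‖N‖ := by
  rw [Ring.lie_def]
  calc _ ≤ ‖M * N‖ + ‖N * M‖ := norm_sub_le _ _
    _ ≤ ‖M‖ * ‖N‖ + ‖N‖ * ‖M‖ := add_le_add (norm_mul_le _ _) (norm_mul_le _ _)
    _ = _ := by ring

/-- Time evolution may be moved from one entry of a commutator to the other. -/
lemma norm_lie_phase_conj {H : 𝔸} (hH : IsSelfAdjoint H) (t : ℝ) (M N : 𝔸) :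
    ‖⁅phase H t * M * phase H (-t), N⁆‖ = ‖⁅M, phase H (-t) * N * phase H t⁆‖ := by
  rw [← norm_phase_conj hH t ⁅M, phase H (-t) * N * phase H t⁆]
  congr 1
  simp only [Ring.lie_def, mul_sub, sub_mul, mul_assoc, phase_mul_phase_neg_assoc,
    phase_mul_phase_neg, mul_one]

/-- Comparison of the dynamics generated by `K + S` with the one generated by `K`, at the level of
the norm of a commutator: `U` is any function whose derivative dominates the commutators of the
evolved perturbation with `N`. -/
lemma norm_lie_evolve_le {K S : 𝔸} (hK : IsSelfAdjoint K) (hS : IsSelfAdjoint S) (M N : 𝔸)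
    {t : ℝ} (ht : 0 ≤ t) {U U' : ℝ → ℝ} (hU : ∀ s, HasDerivAt U (U' s) s)
    (h0 : ‖⁅phase K t * M * phase K (-t), N⁆‖ ≤ U 0)
    (h : ∀ s, 0 ≤ s →
      2 * ‖M‖ * ‖⁅phase (K + S) s * S * phase (K + S) (-s), N⁆‖ ≤ U' s) :
    ‖⁅phase (K + S) t * M * phase (K + S) (-t), N⁆‖ ≤ U t := by
  have hH : IsSelfAdjoint (K + S) := hK.add hS
  set H := K + S with hHdef
  set M' := phase K t * M * phase K (-t) with hM'
  have hM'n : ‖M'‖ = ‖M‖ := norm_phase_conj hK t M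
  let Bs : ℝ → 𝔸 := fun s => phase H (-s) * N * phase H s
  -- This path interpolates between the two dynamics. At `s = 0` it is the commutator for `K` alone,
  -- and at `s = t` it has the norm of the commutator for `K + S`.
  let k : ℝ → 𝔸 := fun s => ⁅M', phase K s * Bs s * phase K (-s)⁆
  let k' : ℝ → 𝔸 := fun s => ⁅M', -(phase K s * (Complex.I • ⁅S, Bs s⁆) * phase K (-s))⁆
  have hBs : ∀ s, HasDerivAt Bs (-(Complex.I • ⁅H, Bs s⁆)) s := by
    intro s
    have h1 := ((hasDerivAt_phase_neg H s).mul_const N).mul (hasDerivAt_phase H s)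
    refine h1.congr_deriv ?_
    have c1 : phase H (-s) * H = H * phase H (-s) :=
      (commute_phase (Commute.refl H) (-s)).eq.symm
    rw [mul_smul_comm, c1]
    simp only [Bs, Ring.lie_def, mul_assoc, smul_sub, mul_smul_comm, smul_mul_assoc, neg_mul]
    abel
  have hk : ∀ s, HasDerivAt k (k' s) s := by
    intro s
    have h1 := ((hasDerivAt_phase K s).mul (hBs s)).mul (hasDerivAt_phase_neg K s)
    have h2 := (h1.const_mul M').sub (h1.mul_const M')
    refine h2.congr_deriv ?_
    have c1 : phase K (-s) * K = K * phase K (-s) :=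
      (commute_phase (Commute.refl K) (-s)).eq.symm
    -- The contributions of `K` to the derivative cancel, which leaves only the perturbation `S`.
    have e : (phase K s * (Complex.I • K) * Bs s + phase K s * -(Complex.I • ⁅H, Bs s⁆)) *
        phase K (-s) + phase K s * Bs s * -(phase K (-s) * (Complex.I • K)) =
        -(phase K s * (Complex.I • ⁅S, Bs s⁆) * phase K (-s)) := by
      simp only [hHdef, Ring.lie_def, mul_sub, sub_mul, mul_assoc, smul_sub, mul_smul_comm,
        smul_mul_assoc, mul_neg, neg_mul, add_mul, mul_add, smul_add, c1]
      abel
    simp only [k']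
    rw [Ring.lie_def M']
    erw [e]
  have hk' : ∀ s, 0 ≤ s → ‖k' s‖ ≤ U' s := by
    intro s hs
    refine le_trans ?_ (h s hs)
    refine (norm_lie_le _ _).trans ?_
    rw [hM'n, norm_neg, norm_phase_conj hK, norm_smul, Complex.norm_I, one_mul,
      norm_lie_phase_conj hH]
  have key := image_norm_le_of_norm_deriv_right_le_deriv_boundary' (f := k) (f' := k')
    (a := 0) (b := t) (fun s _ => (hk s).continuousAt.continuousWithinAt)
    (fun s _ => (hk s).hasDerivWithinAt) (B := U) (B' := U')
    (by simpa [k, Bs, phase_zero] using h0)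
    (fun s _ => (hU s).continuousAt.continuousWithinAt)
    (fun s _ => (hU s).hasDerivWithinAt) (fun s hs => hk' s hs.1) (x := t) ⟨ht, le_rfl⟩
  refine le_trans (le_of_eq ?_) key
  rw [norm_lie_phase_conj hH]
  change _ = ‖⁅M', phase K t * Bs t * phase K (-t)⁆‖
  -- At `s = t` both entries carry the same conjugation by `phase K t`, which does not change the
  -- norm.
  have := norm_lie_phase_conj hK t M (phase K t * Bs t * phase K (-t))
  rw [hM', this]
  simp only [mul_assoc, phase_neg_mul_phase_assoc, phase_neg_mul_phase, mul_one]
  simp only [Bs, mul_assoc]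

end CStar

/-! ### Embeddings of local algebras -/

section Embed

variable {V : Type*} [DecidableEq V] {n : V → ℕ} {X Y L : Finset V}

/-- The configuration that is `s` on `X` and `s'` elsewhere. -/
def Config.glue (s : Config n X) (s' : Config n L) : Config n L :=
  fun y => if h : y.1 ∈ X then s ⟨y.1, h⟩ else s' y

lemma Config.restrict_glue (hX : X ⊆ L) (s : Config n X) (s' : Config n L) :
    (s.glue s').restrict hX = s := by
  ext x
  simp [Config.restrict, Config.glue]

lemma Config.glue_restrict_of_forall (hX : X ⊆ L) {s s' : Config n L}
    (h : ∀ y : L, y.1 ∉ X → s y = s' y) : (s'.restrict hX).glue s = s' := by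
  funext y
  by_cases hy : y.1 ∈ X
  · simp [Config.restrict, Config.glue, hy]
  · simp [Config.glue, hy, h y hy]

lemma Config.glue_apply_of_notMem (s : Config n X) (s' : Config n L) (y : L) (hy : y.1 ∉ X) :
    s.glue s' y = s' y := by
  simp [Config.glue, hy]

/-- A configuration agreeing with `s` off `X` is determined by its restriction to `X`. This
reindexing evaluates matrix products whose left factor is embedded from `X`. -/
lemma sum_ite_agree (hX : X ⊆ L) (s : Config n L) (f : Config n L → ℂ) :
    (∑ u : Config n L, if ∀ y : L, y.1 ∉ X → s y = u y then f u else 0) =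
      ∑ v : Config n X, f (v.glue s) := by
  rw [← Finset.sum_filter]
  refine Finset.sum_bij' (fun u _ => u.restrict hX) (fun v _ => v.glue s) ?_ ?_ ?_ ?_ ?_
  · simp
  · intro v _
    simpa using fun a b ha => (Config.glue_apply_of_notMem v s ⟨a, b⟩ ha).symm
  · intro u hu
    exact Config.glue_restrict_of_forall hX (Finset.mem_filter.1 hu).2
  · intro v _
    exact Config.restrict_glue hX v s
  · intro u hu
    rw [Config.glue_restrict_of_forall hX (Finset.mem_filter.1 hu).2]

lemma embed_mul (hX : X ⊆ L) (A B : LocalAlg n X) :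
    embed hX (A * B) = embed hX A * embed hX B := by
  ext s s'
  simp only [embed, Matrix.mul_apply, Matrix.of_apply, ite_mul, zero_mul]
  rw [sum_ite_agree hX s]
  simp only [Config.restrict_glue, mul_ite, mul_zero]
  by_cases h : ∀ y : L, y.1 ∉ X → s y = s' y
  · rw [if_pos h]
    refine Finset.sum_congr rfl fun v _ => ?_
    rw [if_pos]
    intro y hy
    rw [Config.glue_apply_of_notMem _ _ _ hy, h y hy]
  · rw [if_neg h]
    refine (Finset.sum_eq_zero fun v _ => if_neg fun h' => h fun y hy => ?_).symm
    rw [← h' y hy, Config.glue_apply_of_notMem _ _ _ hy]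

lemma star_embed (hX : X ⊆ L) (A : LocalAlg n X) : star (embed hX A) = embed hX (star A) := by
  ext s s'
  simp only [embed, Matrix.star_apply, Matrix.of_apply]
  simp only [eq_comm (a := s' _), apply_ite star, star_zero]

/-- The embedding `A ↦ A ⊗ 1` as a homomorphism of non-unital star algebras. -/
def embedHom (n : V → ℕ) (hX : X ⊆ L) : LocalAlg n X →⋆ₙₐ[ℂ] LocalAlg n L where
  toFun := embed hX
  map_smul' c A := by
    ext s s'
    simp [embed]
  map_zero' := by
    ext s s'
    simp [embed]
  map_add' A B := by
    ext s s'
    by_cases h : ∀ y : L, y.1 ∉ X → s y = s' y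
    · simp only [embed, Matrix.of_apply, Matrix.add_apply, if_pos h]
    · simp only [embed, Matrix.of_apply, Matrix.add_apply, if_neg h, add_zero]
  map_mul' := embed_mul hX
  map_star' A := (star_embed hX A).symm

/-- Star homomorphisms between C⋆-algebras are contractive. -/
lemma norm_embed_le (hX : X ⊆ L) (A : LocalAlg n X) : ‖embed hX A‖ ≤ ‖A‖ :=
  NonUnitalStarAlgHom.norm_apply_le (embedHom n hX) A

lemma embed_neg (hX : X ⊆ L) (A : LocalAlg n X) : embed hX (-A) = -embed hX A :=
  map_neg (embedHom n hX) A

lemma isSelfAdjoint_embed (hX : X ⊆ L) {A : LocalAlg n X} (hA : IsSelfAdjoint A) :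
    IsSelfAdjoint (embed hX A) :=
  hA.map (embedHom n hX)

/-- Only one intermediate configuration contributes to the product: `s'` on `X` and `s` elsewhere.
The resulting entry is symmetric under exchange of the two factors, hence commutation. -/
lemma embed_mul_embed_apply (hX : X ⊆ L) (hY : Y ⊆ L) (hXY : Disjoint X Y) (A : LocalAlg n X)
    (B : LocalAlg n Y) (s s' : Config n L) :
    (embed hX A * embed hY B) s s' =
      if ∀ y : L, y.1 ∉ X → y.1 ∉ Y → s y = s' y then
        A (s.restrict hX) (s'.restrict hX) * B (s.restrict hY) (s'.restrict hY) else 0 := by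
  have hd : ∀ y ∈ X, y ∉ Y := fun y h => Finset.disjoint_left.1 hXY h
  simp only [embed, Matrix.mul_apply, Matrix.of_apply, ite_mul, zero_mul]
  rw [sum_ite_agree hX s, Finset.sum_eq_single (s'.restrict hX)]
  · rw [Config.restrict_glue]
    have e : Config.restrict hY ((s'.restrict hX).glue s) = s.restrict hY := by
      funext y
      have : y.1 ∉ X := fun h => hd _ h y.2
      simp [Config.restrict, Config.glue, this]
    rw [e, mul_ite, mul_zero]
    congr 1
    refine propext ⟨fun h y hyX hyY => ?_, fun h y hyY => ?_⟩
    · rw [← h y hyY, Config.glue_apply_of_notMem _ _ _ hyX]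
    · by_cases hyX : y.1 ∈ X
      · simp [Config.glue, Config.restrict, hyX]
      · rw [Config.glue_apply_of_notMem _ _ _ hyX, h y hyX hyY]
  · intro v _ hv
    rw [if_neg, mul_zero]
    refine fun h => hv ?_
    funext x
    have := h ⟨x.1, hX x.2⟩ (hd _ x.2)
    simpa [Config.glue, Config.restrict] using this
  · simp

/-- Observables with disjoint supports commute. -/
lemma commute_embed (hX : X ⊆ L) (hY : Y ⊆ L) (hXY : Disjoint X Y) (A : LocalAlg n X)
    (B : LocalAlg n Y) : Commute (embed hX A) (embed hY B) := by
  ext s s'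
  rw [embed_mul_embed_apply hX hY hXY, embed_mul_embed_apply hY hX hXY.symm]
  simp only [mul_comm (A _ _)]
  congr 1
  exact propext ⟨fun h y a b => h y b a, fun h y a b => h y b a⟩

end Embed

lemma phase_add {𝔸 : Type*} [CStarAlgebra 𝔸] {H K : 𝔸} (h : Commute H K) (t : ℝ) :
    phase (H + K) t = phase H t * phase K t := by
  let _ : NormedAlgebra ℚ 𝔸 := NormedAlgebra.restrictScalars ℚ ℂ 𝔸
  rw [phase, phase, phase, smul_add, NormedSpace.exp_add_of_commute]
  exact (h.smul_right _).smul_left _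

/-- A perturbation that commutes with `H` and `M` does not affect the evolution of `M`. -/
lemma phase_add_conj {𝔸 : Type*} [CStarAlgebra 𝔸] {H K M : 𝔸} (h : Commute H K)
    (hM : Commute M K) (t : ℝ) :
    phase (H + K) t * M * phase (H + K) (-t) = phase H t * M * phase H (-t) := by
  have h1 : phase (H + K) (-t) = phase K (-t) * phase H (-t) := by
    rw [add_comm, phase_add h.symm]
  rw [phase_add h, h1, mul_assoc (phase H t), ← (commute_phase hM t).eq]
  simp only [mul_assoc, phase_mul_phase_neg_assoc]

/-! ### The local Hamiltonian and the evolved commutator -/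

section Dynamics

variable {V : Type*} [DecidableEq V] {n : V → ℕ} {X Y L : Finset V}

lemma evolve_eq_phase (Φ : Interaction n) (L : Finset V) (t : ℝ) (A : LocalAlg n L) :
    evolve Φ L t A = phase (hamiltonian Φ L) t * A * phase (hamiltonian Φ L) (-t) := by
  rw [← exp_neg_eq_phase]
  rfl

/-- Arbitrary subfamilies of terms are allowed so that this covers both parts of the split
Hamiltonian. -/
lemma isSelfAdjoint_sum_term (Φ : Interaction n) (s : Finset {Z : Finset V // Z ∈ L.powerset}) :
    IsSelfAdjoint (∑ Z ∈ s, embed (Finset.mem_powerset.1 Z.2) (Φ.term Z.1)) := by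
  refine isSelfAdjoint_sum _ fun Z _ => ?_
  exact isSelfAdjoint_embed _ (Φ.selfAdjoint Z.1)

lemma isSelfAdjoint_hamiltonian (Φ : Interaction n) (L : Finset V) :
    IsSelfAdjoint (hamiltonian Φ L) :=
  isSelfAdjoint_sum_term Φ Finset.univ

/-- Unitary invariance moves the evolution onto `B` with reversed time. This is the source of the
symmetry between `X` and `Y` in the bounds. -/
lemma norm_evolvedCommutator_swap (Φ : Interaction n) (hX : X ⊆ L) (hY : Y ⊆ L) (t : ℝ)
    (A : LocalAlg n X) (B : LocalAlg n Y) :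
    ‖evolvedCommutator Φ hX hY t A B‖ = ‖evolvedCommutator Φ hY hX (-t) B A‖ := by
  rw [evolvedCommutator, evolvedCommutator, evolve_eq_phase, evolve_eq_phase,
    norm_lie_phase_conj (isSelfAdjoint_hamiltonian Φ L), neg_neg, Ring.lie_def, Ring.lie_def,
    norm_sub_rev]

lemma norm_evolvedCommutator_le (Φ : Interaction n) (hX : X ⊆ L) (hY : Y ⊆ L) (t : ℝ)
    (A : LocalAlg n X) (B : LocalAlg n Y) :
    ‖evolvedCommutator Φ hX hY t A B‖ ≤ 2 * ‖A‖ * ‖B‖ := by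
  refine (norm_lie_le _ _).trans ?_
  rw [evolve_eq_phase, norm_phase_conj (isSelfAdjoint_hamiltonian Φ L)]
  gcongr <;> exact norm_embed_le _ _

/-- The reversed interaction `-Φ`. -/
def Interaction.neg (Φ : Interaction n) : Interaction n where
  term X := -Φ.term X
  selfAdjoint X := (Φ.selfAdjoint X).neg

lemma hamiltonian_neg (Φ : Interaction n) (L : Finset V) :
    hamiltonian Φ.neg L = -hamiltonian Φ L := by
  simp only [hamiltonian, Interaction.neg, embed_neg, Finset.sum_neg_distrib]

lemma evolvedCommutator_neg (Φ : Interaction n) (hX : X ⊆ L) (hY : Y ⊆ L) (t : ℝ)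
    (A : LocalAlg n X) (B : LocalAlg n Y) :
    evolvedCommutator Φ.neg hX hY t A B = evolvedCommutator Φ hX hY (-t) A B := by
  simp only [evolvedCommutator, evolve_eq_phase, hamiltonian_neg, phase_neg_left]

/-- The indicator of the sets that meet `Y`. -/
noncomputable def meets (Y Z : Finset V) : ℝ := if Disjoint Z Y then 0 else 1

open Classical in
/-- The terms of the Hamiltonian outside the surface of `X` do not couple `X` to its complement. -/
lemma norm_lie_decoupled_le (Φ : Interaction n) (hX : X ⊆ L) (hY : Y ⊆ L) (t : ℝ)
    (A : LocalAlg n X) (B : LocalAlg n Y) {K : LocalAlg n L}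
    (hK : K = ∑ Z : {Z : Finset V // Z ∈ L.powerset} with Z.1 ∉ surface X,
      embed (Finset.mem_powerset.1 Z.2) (Φ.term Z.1)) :
    ‖⁅phase K t * embed hX A * phase K (-t), embed hY B⁆‖ ≤ 2 * ‖A‖ * ‖B‖ * meets Y X := by
  by_cases hXY : Disjoint X Y
  · suffices h : Commute (phase K t * embed hX A * phase K (-t)) (embed hY B) by
      rw [Ring.lie_def, h.eq, sub_self, norm_zero, meets, if_pos hXY, mul_zero]
    have hsplit := Finset.sum_filter_add_sum_filter_not
      (Finset.univ.filter fun Z : {Z : Finset V // Z ∈ L.powerset} => Z.1 ∉ surface X)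
      (fun Z => Z.1 ⊆ X) (fun Z => embed (Finset.mem_powerset.1 Z.2) (Φ.term Z.1))
    rw [← hK] at hsplit
    -- A set outside the surface lies in `X` or misses `X`. The terms missing `X` commute with `A`
    -- and with the terms inside `X`, so they drop out of the evolution.
    have hdisj : ∀ Z ∈ (Finset.univ.filter
        fun Z : {Z : Finset V // Z ∈ L.powerset} => Z.1 ∉ surface X).filter
          (fun Z => ¬ Z.1 ⊆ X), Disjoint X Z.1 := by
      intro Z hZ
      simp only [Finset.mem_filter, Finset.mem_univ, true_and] at hZ
      rw [Finset.disjoint_right]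
      intro z hz hzX
      exact hZ.1 ⟨⟨z, hz, hzX⟩, Finset.not_subset.1 hZ.2⟩
    rw [← hsplit, phase_add_conj]
    · have hc : Commute (embed hY B) (∑ Z ∈ (Finset.univ.filter
        fun Z : {Z : Finset V // Z ∈ L.powerset} => Z.1 ∉ surface X).filter
          (fun Z => Z.1 ⊆ X), embed (Finset.mem_powerset.1 Z.2) (Φ.term Z.1)) := by
        refine Commute.sum_right _ _ _ fun Z hZ => ?_
        exact commute_embed _ _ (hXY.mono_left (Finset.mem_filter.1 hZ).2).symm _ _
      exact (((commute_phase hc t).mul_right (commute_embed _ _ hXY.symm _ _)).mul_right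
        (commute_phase hc (-t))).symm
    · refine Commute.sum_left _ _ _ fun Z hZ => Commute.sum_right _ _ _ fun Z' hZ' => ?_
      exact commute_embed _ _ ((hdisj Z' hZ').mono_left (Finset.mem_filter.1 hZ).2) _ _
    · exact Commute.sum_right _ _ _ fun Z hZ => commute_embed _ _ (hdisj Z hZ) _ _
  · rw [meets, if_neg hXY, mul_one]
    refine (norm_lie_le _ _).trans ?_
    rw [norm_phase_conj (hK ▸ isSelfAdjoint_sum_term Φ _)]
    gcongr <;> exact norm_embed_le _ _

open Classical in
/-- The commutator of an observable evolved for time `t` is controlled by the commutators, at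
earlier times, of the interaction terms that cross the surface of its support. -/
lemma norm_evolvedCommutator_le_of_hasDerivAt (Φ : Interaction n) (hX : X ⊆ L) (hY : Y ⊆ L)
    {t : ℝ} (ht : 0 ≤ t) (A : LocalAlg n X) (B : LocalAlg n Y) {U U' : ℝ → ℝ}
    (hU : ∀ s, HasDerivAt U (U' s) s) (h0 : 2 * ‖A‖ * ‖B‖ * meets Y X ≤ U 0) (b : Finset V → ℝ → ℝ)
    (hb : ∀ Z (hZ : Z ⊆ L), ∀ s, 0 ≤ s → ‖evolvedCommutator Φ hZ hY s (Φ.term Z) B‖ ≤ b Z s)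
    (h : ∀ s, 0 ≤ s → 2 * ‖A‖ * ∑ Z ∈ L.powerset with Z ∈ surface X, b Z s ≤ U' s) :
    ‖evolvedCommutator Φ hX hY t A B‖ ≤ U t := by
  set S : LocalAlg n L := ∑ Z : {Z : Finset V // Z ∈ L.powerset} with Z.1 ∈ surface X,
      embed (Finset.mem_powerset.1 Z.2) (Φ.term Z.1) with hS
  set K : LocalAlg n L := ∑ Z : {Z : Finset V // Z ∈ L.powerset} with Z.1 ∉ surface X,
      embed (Finset.mem_powerset.1 Z.2) (Φ.term Z.1) with hK
  have hKS : hamiltonian Φ L = K + S := by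
    rw [hS, hK, add_comm]
    exact (Finset.sum_filter_add_sum_filter_not _ _ _).symm
  rw [evolvedCommutator, evolve_eq_phase, hKS]
  refine norm_lie_evolve_le (isSelfAdjoint_sum_term Φ _) (isSelfAdjoint_sum_term Φ _) _ _ ht hU
    ((norm_lie_decoupled_le Φ hX hY t A B hK).trans h0) fun s hs => le_trans ?_ (h s hs)
  rw [← hKS, Finset.mul_sum, Finset.sum_mul, Ring.lie_def, Finset.sum_mul, Finset.mul_sum,
    ← Finset.sum_sub_distrib]
  have hsum : (∑ Z ∈ L.powerset with Z ∈ surface X, b Z s) =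
      ∑ Z : {Z : Finset V // Z ∈ L.powerset} with Z.1 ∈ surface X, b Z.1 s := by
    rw [Finset.sum_filter, Finset.sum_filter]
    exact (Finset.sum_coe_sort L.powerset fun Z => if Z ∈ surface X then b Z s else 0).symm
  rw [hsum]
  refine mul_le_mul (mul_le_mul_of_nonneg_left (norm_embed_le _ _) zero_le_two) ?_
    (norm_nonneg _) (by positivity)
  refine norm_sum_le_of_le _ fun Z _ => ?_
  have := hb Z.1 (Finset.mem_powerset.1 Z.2) s hs
  rwa [evolvedCommutator, evolve_eq_phase, Ring.lie_def] at this

lemma hasDerivAt_pow_div_factorial (N : ℝ) (k : ℕ) (s : ℝ) :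
    HasDerivAt (fun s : ℝ => (N * s) ^ (k + 1) / (k + 1).factorial)
      (N * ((N * s) ^ k / k.factorial)) s := by
  have h := (((hasDerivAt_id s).const_mul N).pow (k + 1)).div_const ((k + 1).factorial : ℝ)
  refine h.congr_deriv ?_
  have hk : (k.factorial : ℝ) ≠ 0 := by positivity
  have hk' : (k : ℝ) + 1 ≠ 0 := by positivity
  rw [Nat.factorial_succ]
  push_cast
  simp only [id, mul_one]
  field_simp

/-! ### Iteration of the comparison inequality -/

section Comparison

open Classical in
/-- The Lieb-Robinson bound from a weight `D` on the sets of sites that dominates the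
interaction terms crossing a surface. The last term is the remainder after `k` iterations. -/
lemma norm_evolvedCommutator_le_iterate (Φ : Interaction n) (hY : Y ⊆ L) (B : LocalAlg n Y)
    {κ : ℝ} (hκ : 0 < κ) {D : Finset V → ℝ}
    (h1 : ∀ X ⊆ L, ∑ Z ∈ L.powerset with Z ∈ surface X, ‖Φ.term Z‖ * meets Y Z ≤ D X)
    (h2 : ∀ X ⊆ L, ∑ Z ∈ L.powerset with Z ∈ surface X, ‖Φ.term Z‖ * D Z ≤ κ * D X) (k : ℕ) :
    ∀ (X : Finset V) (hX : X ⊆ L) (A : LocalAlg n X) (t : ℝ), 0 ≤ t →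
      ‖evolvedCommutator Φ hX hY t A B‖ ≤ 2 * ‖A‖ * ‖B‖ *
        (meets Y X + (Real.exp (2 * κ * t) - 1) / κ * D X +
          (2 * (∑ Z ∈ L.powerset, ‖Φ.term Z‖) * t) ^ k / k.factorial) := by
  set N := ∑ Z ∈ L.powerset, ‖Φ.term Z‖ with hN
  have hm : ∀ X, 0 ≤ meets Y X := fun X => by unfold meets; split_ifs <;> norm_num
  have hD : ∀ X ⊆ L, 0 ≤ D X := fun X hX =>
    (Finset.sum_nonneg fun Z _ => mul_nonneg (norm_nonneg _) (hm Z)).trans (h1 X hX)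
  have hφ : ∀ s, 0 ≤ s → 0 ≤ (Real.exp (2 * κ * s) - 1) / κ := fun s hs =>
    div_nonneg (sub_nonneg.2 (Real.one_le_exp (by positivity))) hκ.le
  induction k with
  | zero =>
    intro X hX A t ht
    refine (norm_evolvedCommutator_le Φ hX hY t A B).trans ?_
    refine le_mul_of_one_le_right (by positivity) ?_
    have := mul_nonneg (hφ t ht) (hD X hX)
    have := hm X
    simp only [pow_zero, Nat.factorial_zero, Nat.cast_one, div_one]
    linarith
  | succ k ih =>
    intro X hX A t ht
    have hU : ∀ s, HasDerivAt (fun s => 2 * ‖A‖ * ‖B‖ *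
        (meets Y X + (Real.exp (2 * κ * s) - 1) / κ * D X +
          (2 * N * s) ^ (k + 1) / (k + 1).factorial))
        (2 * ‖A‖ * ‖B‖ * (2 * Real.exp (2 * κ * s) * D X +
          2 * N * ((2 * N * s) ^ k / k.factorial))) s := by
      intro s
      refine HasDerivAt.const_mul _ ?_
      refine HasDerivAt.add ?_ (hasDerivAt_pow_div_factorial _ _ _)
      refine HasDerivAt.const_add _ (HasDerivAt.mul_const ?_ _)
      have := (((hasDerivAt_id s).const_mul (2 * κ)).exp.sub_const 1).div_const κ
      refine this.congr_deriv ?_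
      simp only [id]
      field_simp
    -- At time `0` only the `meets` term survives. The derivative closes because `1 + κφ = e^{2κs}`,
    -- and integrating the old remainder raises its order by one.
    refine norm_evolvedCommutator_le_of_hasDerivAt Φ hX hY ht A B hU (by simp)
      (fun Z s => 2 * ‖Φ.term Z‖ * ‖B‖ *
        (meets Y Z + (Real.exp (2 * κ * s) - 1) / κ * D Z + (2 * N * s) ^ k / k.factorial))
      (fun Z hZ s hs => ih Z hZ _ s hs) fun s hs => ?_
    set r := (2 * N * s) ^ k / (k.factorial : ℝ)
    set φ := (Real.exp (2 * κ * s) - 1) / κ with hφdef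
    have hN0 : 0 ≤ N := Finset.sum_nonneg fun _ _ => norm_nonneg _
    have hr : 0 ≤ r := by positivity
    have h3 : ∑ Z ∈ L.powerset with Z ∈ surface X, ‖Φ.term Z‖ ≤ N :=
      Finset.sum_le_sum_of_subset_of_nonneg (Finset.filter_subset _ _) fun _ _ _ => norm_nonneg _
    have e : ∑ Z ∈ L.powerset with Z ∈ surface X,
        2 * ‖Φ.term Z‖ * ‖B‖ * (meets Y Z + φ * D Z + r) =
        2 * ‖B‖ * ((∑ Z ∈ L.powerset with Z ∈ surface X, ‖Φ.term Z‖ * meets Y Z) +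
          φ * (∑ Z ∈ L.powerset with Z ∈ surface X, ‖Φ.term Z‖ * D Z) +
          (∑ Z ∈ L.powerset with Z ∈ surface X, ‖Φ.term Z‖) * r) := by
      rw [Finset.mul_sum, Finset.sum_mul, ← Finset.sum_add_distrib, ← Finset.sum_add_distrib,
        Finset.mul_sum]
      exact Finset.sum_congr rfl fun Z _ => by ring
    rw [e]
    calc _ ≤ 2 * ‖A‖ * (2 * ‖B‖ * (D X + φ * (κ * D X) + N * r)) := by
          have := hφ s hs
          gcongr
          · exact h1 X hX
          · exact h2 X hX
      _ = _ := by
          rw [hφdef]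
          field_simp
          ring

open Classical in
lemma norm_evolvedCommutator_le_of_weight (Φ : Interaction n) (hX : X ⊆ L) (hY : Y ⊆ L)
    (hXY : Disjoint X Y) (A : LocalAlg n X) (B : LocalAlg n Y)
    {κ : ℝ} (hκ : 0 < κ) {D : Finset V → ℝ}
    (h1 : ∀ X ⊆ L, ∑ Z ∈ L.powerset with Z ∈ surface X, ‖Φ.term Z‖ * meets Y Z ≤ D X)
    (h2 : ∀ X ⊆ L, ∑ Z ∈ L.powerset with Z ∈ surface X, ‖Φ.term Z‖ * D Z ≤ κ * D X) (t : ℝ) :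
    ‖evolvedCommutator Φ hX hY t A B‖ ≤
      2 * ‖A‖ * ‖B‖ * ((Real.exp (2 * κ * |t|) - 1) / κ * D X) := by
  have key : ∀ (Ψ : Interaction n), (∀ Z, ‖Ψ.term Z‖ = ‖Φ.term Z‖) → ∀ s, 0 ≤ s →
      ‖evolvedCommutator Ψ hX hY s A B‖ ≤
        2 * ‖A‖ * ‖B‖ * ((Real.exp (2 * κ * s) - 1) / κ * D X) := by
    intro Ψ hΨ s hs
    simp only [← hΨ] at h1 h2
    refine ge_of_tendsto' (f := fun k : ℕ => 2 * ‖A‖ * ‖B‖ *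
        (meets Y X + (Real.exp (2 * κ * s) - 1) / κ * D X +
          (2 * (∑ Z ∈ L.powerset, ‖Ψ.term Z‖) * s) ^ k / k.factorial)) (x := Filter.atTop) ?_
      fun k => norm_evolvedCommutator_le_iterate Ψ hY B hκ h1 h2 k X hX A s hs
    refine Filter.Tendsto.const_mul _ ?_
    have := (FloorSemiring.tendsto_pow_div_factorial_atTop
      (2 * (∑ Z ∈ L.powerset, ‖Ψ.term Z‖) * s)).const_add
      (meets Y X + (Real.exp (2 * κ * s) - 1) / κ * D X)
    simpa [meets, hXY] using this
  rcases le_total 0 t with ht | ht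
  · rw [abs_of_nonneg ht]
    exact key Φ (fun _ => rfl) t ht
  · rw [abs_of_nonpos ht]
    -- Negative times are positive times for `-Φ`, whose terms have the same norms.
    have := key Φ.neg (fun Z => norm_neg _) (-t) (by linarith)
    rwa [evolvedCommutator_neg, neg_neg] at this

end Comparison

end Dynamics

/-! ### Decay functions -/

section Decay

lemma sum_le_toReal_mul_of_tsum_le {ι : Type*} {P : ι → Prop} (s : Finset ι) (hs : ∀ i ∈ s, P i)
    {f : ι → ℝ} (hf : ∀ i, 0 ≤ f i) {w : ℝ} (hw : 0 < w) {N : ℝ≥0∞} (hN : N ≠ ∞)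
    (h : ∑' i : {i // P i}, ENNReal.ofReal (f i.1 / w) ≤ N) :
    ∑ i ∈ s, f i ≤ N.toReal * w := by
  classical
  have h1 : ∑ i ∈ s, ENNReal.ofReal (f i / w) ≤ N := by
    refine le_trans ?_ h
    rw [← Finset.sum_subtype_of_mem (fun i => ENNReal.ofReal (f i / w)) hs]
    exact ENNReal.sum_le_tsum _
  rw [← ENNReal.ofReal_sum_of_nonneg fun i _ => div_nonneg (hf i) hw.le] at h1
  have h2 := (ENNReal.ofReal_le_iff_le_toReal hN).1 h1
  rwa [← Finset.sum_div, div_le_iff₀ hw] at h2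

lemma sum_le_toReal_of_tsum_le {ι : Type*} (s : Finset ι)
    {f : ι → ℝ} (hf : ∀ i, 0 ≤ f i) {N : ℝ≥0∞} (hN : N ≠ ∞)
    (h : ∑' i, ENNReal.ofReal (f i) ≤ N) : ∑ i ∈ s, f i ≤ N.toReal := by
  rw [← ENNReal.ofReal_le_iff_le_toReal hN, ENNReal.ofReal_sum_of_nonneg fun i _ => hf i]
  exact (ENNReal.sum_le_tsum s).trans h

variable {V : Type*} [MetricSpace V] {F : ℝ → ℝ}

lemma IsDecayFunction.weighted_pos (hF : IsDecayFunction V F) (a : ℝ) (x y : V) :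
    0 < weighted F a (dist x y) :=
  mul_pos (Real.exp_pos _) (hF.pos _ dist_nonneg)

/-- By the triangle inequality the exponential factors in the quotient combine to at most `1`, so
`C_a ≤ C`. -/
lemma IsDecayFunction.convConst_weighted_ne_top (hF : IsDecayFunction V F) {a : ℝ} (ha : 0 ≤ a) :
    convConst V (weighted F a) ≠ ∞ := by
  refine (lt_of_le_of_lt ?_ hF.convConst_lt_top).ne
  refine iSup_mono fun x => iSup_mono fun y => ENNReal.tsum_le_tsum fun z =>
    ENNReal.ofReal_le_ofReal ?_
  have p1 := hF.pos _ (dist_nonneg (x := x) (y := z))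
  have p2 := hF.pos _ (dist_nonneg (x := z) (y := y))
  have p3 := hF.pos _ (dist_nonneg (x := x) (y := y))
  have e : weighted F a (dist x z) * weighted F a (dist z y) / weighted F a (dist x y) =
      Real.exp (-a * (dist x z + dist z y - dist x y)) *
        (F (dist x z) * F (dist z y) / F (dist x y)) := by
    simp only [weighted]
    rw [show -a * (dist x z + dist z y - dist x y) =
      -a * dist x z + -a * dist z y - -a * dist x y by ring, Real.exp_sub, Real.exp_add]
    field_simp
  rw [e]
  refine mul_le_of_le_one_left (by positivity) (Real.exp_le_one_iff.2 ?_)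
  have := dist_triangle x z y
  nlinarith

/-- The diagonal term `x = y = z` equals `F_a(0) > 0`. -/
lemma IsDecayFunction.convConst_weighted_ne_zero [Nonempty V] (hF : IsDecayFunction V F) (a : ℝ) :
    convConst V (weighted F a) ≠ 0 := by
  obtain ⟨x⟩ := ‹Nonempty V›
  intro h
  simp only [convConst, ENNReal.iSup_eq_zero, ENNReal.tsum_eq_zero, ENNReal.ofReal_eq_zero] at h
  have hp := hF.weighted_pos a x x
  exact absurd (h x x x) (not_le.2 (by positivity))

lemma IsDecayFunction.sum_convolution_le (hF : IsDecayFunction V F) {a : ℝ} (ha : 0 ≤ a)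
    (L : Finset V) (x y : V) :
    ∑ z ∈ L, weighted F a (dist x z) * weighted F a (dist z y) ≤
      (convConst V (weighted F a)).toReal * weighted F a (dist x y) := by
  have hw := hF.weighted_pos a
  have h := sum_le_toReal_of_tsum_le L
    (f := fun z => weighted F a (dist x z) * weighted F a (dist z y) / weighted F a (dist x y))
    (fun z => (div_pos (mul_pos (hw _ _) (hw _ _)) (hw _ _)).le) (hF.convConst_weighted_ne_top ha)
    (le_iSup₂ (f := fun x y => ∑' z : V, ENNReal.ofReal
      (weighted F a (dist x z) * weighted F a (dist z y) / weighted F a (dist x y))) x y)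
  rwa [← Finset.sum_div, div_le_iff₀ (hw x y)] at h

lemma IsDecayFunction.sum_le_decayNorm (hF : IsDecayFunction V F) (s : Finset V) (x : V) :
    ∑ y ∈ s, F (dist x y) ≤ (decayNorm V F).toReal :=
  sum_le_toReal_of_tsum_le s (fun _ => (hF.pos _ dist_nonneg).le) hF.decayNorm_lt_top.ne
    (le_iSup (fun x => ∑' y : V, ENNReal.ofReal (F (dist x y))) x)

lemma setDist_toReal_le_dist {X Y : Finset V} {x y : V} (hx : x ∈ X) (hy : y ∈ Y) :
    (setDist X Y).toReal ≤ dist x y := by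
  rw [dist_edist]
  refine ENNReal.toReal_mono (edist_ne_top x y) ?_
  exact (iInf₂_le x hx).trans (iInf₂_le y hy)

lemma setDist_comm (X Y : Finset V) : setDist X Y = setDist Y X := by
  simp only [setDist]
  rw [iInf₂_comm]
  simp only [edist_comm]

lemma disjoint_of_setDist_pos {X Y : Finset V} (h : 0 < setDist X Y) : Disjoint X Y := by
  rw [Finset.disjoint_left]
  intro x hx hy
  have : setDist X Y ≤ edist x x := (iInf₂_le x hx).trans (iInf₂_le x hy)
  rw [edist_self] at this
  exact absurd h (not_lt.2 this)

end Decay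

/-! ### Surface norms -/

section Norms

variable {V : Type*} [DecidableEq V] [MetricSpace V] {n : V → ℕ} {F : ℝ → ℝ} {a : ℝ}

/-- The first of the two sums in the definition of `Interaction.surfaceSum`. -/
noncomputable def Interaction.halfSurfaceSum (Φ : Interaction n) (F : ℝ → ℝ) (a : ℝ) (U : Set V)
    (X Y : Finset V) : ℝ :=
  ∑ x ∈ X, ∑ y ∈ Y, (Φ.surfaceNorm F a U X x).toReal * weighted F a (dist x y)

lemma Interaction.surfaceSum_eq_min (Φ : Interaction n) (F : ℝ → ℝ) (a : ℝ) (U : Set V)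
    (X Y : Finset V) :
    Φ.surfaceSum F a U X Y = min (Φ.halfSurfaceSum F a U X Y) (Φ.halfSurfaceSum F a U Y X) := by
  rw [surfaceSum, halfSurfaceSum, halfSurfaceSum, Finset.sum_comm (s := Y)]
  simp only [dist_comm]

lemma Interaction.surfaceNorm_mono (Φ : Interaction n) (F : ℝ → ℝ) (a : ℝ) {U W : Set V}
    (h : U ⊆ W) (X : Finset V) (x : V) :
    Φ.surfaceNorm F a U X x ≤ Φ.surfaceNorm F a W X x := by
  unfold surfaceNorm
  split_ifs
  · exact biSup_mono h
  · exact le_rfl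

lemma Interaction.surfaceNorm_le_norm (Φ : Interaction n) (F : ℝ → ℝ) (a : ℝ) (U : Set V)
    (X : Finset V) (x : V) : Φ.surfaceNorm F a U X x ≤ Φ.norm F a := by
  unfold surfaceNorm
  split_ifs
  · refine iSup₂_le fun y _ => le_trans ?_ (le_iSup₂ (f := fun x y =>
      ∑' Z : {Z : Finset V // x ∈ Z ∧ y ∈ Z},
        ENNReal.ofReal (‖Φ.term Z.1‖ / weighted F a (dist x y))) x y)
    exact ENNReal.tsum_mono_subtype
      (fun Z => ENNReal.ofReal (‖Φ.term Z‖ / weighted F a (dist x y)))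
      (s := {Z | Z ∈ surface X ∧ x ∈ Z ∧ y ∈ Z}) (t := {Z | x ∈ Z ∧ y ∈ Z}) fun Z hZ => hZ.2
  · exact bot_le

variable {Φ : Interaction n}

lemma Interaction.surfaceNorm_ne_top (hΦ : Φ.MemB F a) (U : Set V) (X : Finset V) (x : V) :
    Φ.surfaceNorm F a U X x ≠ ∞ :=
  ((Φ.surfaceNorm_le_norm F a U X x).trans_lt hΦ).ne

lemma Interaction.surfaceNorm_toReal_le (hΦ : Φ.MemB F a) (U : Set V) (X : Finset V) (x : V) :
    (Φ.surfaceNorm F a U X x).toReal ≤ (Φ.norm F a).toReal :=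
  ENNReal.toReal_mono hΦ.ne (Φ.surfaceNorm_le_norm F a U X x)

lemma Interaction.surfaceNorm_eq_zero_of_notMem_boundary {U : Set V} {X : Finset V} {x : V}
    (hx : x ∉ boundary Φ X) : Φ.surfaceNorm F a U X x = 0 := by
  unfold surfaceNorm
  split_ifs with hX
  · simp only [ENNReal.iSup_eq_zero, ENNReal.tsum_eq_zero]
    rintro y - ⟨Z, hZ, hxZ, -⟩
    have : Φ.term Z = 0 := by
      by_contra h
      exact hx ⟨hX, Z, hZ, hxZ, h⟩
    simp [this]
  · rfl

lemma Interaction.sum_surface_le (hF : IsDecayFunction V F) (hΦ : Φ.MemB F a) {L X : Finset V}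
    {x y : V} [DecidablePred fun Z => Z ∈ surface X ∧ x ∈ Z ∧ y ∈ Z] (hx : x ∈ X) (hy : y ∈ L) :
    ∑ Z ∈ L.powerset with Z ∈ surface X ∧ x ∈ Z ∧ y ∈ Z, ‖Φ.term Z‖ ≤
      (Φ.surfaceNorm F a (L : Set V) X x).toReal * weighted F a (dist x y) := by
  refine sum_le_toReal_mul_of_tsum_le (P := fun Z => Z ∈ surface X ∧ x ∈ Z ∧ y ∈ Z) _
    (fun Z hZ => (Finset.mem_filter.1 hZ).2) (fun _ => norm_nonneg _) (hF.weighted_pos a x y)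
    (surfaceNorm_ne_top hΦ _ X x) ?_
  rw [surfaceNorm, if_pos hx]
  exact le_iSup₂ (f := fun y (_ : y ∈ (L : Set V)) =>
    ∑' Z : {Z : Finset V // Z ∈ surface X ∧ x ∈ Z ∧ y ∈ Z},
      ENNReal.ofReal (‖Φ.term Z.1‖ / weighted F a (dist x y))) y hy

lemma Interaction.halfSurfaceSum_nonneg (hF : IsDecayFunction V F) (U : Set V)
    (X Y : Finset V) : 0 ≤ Φ.halfSurfaceSum F a U X Y :=
  Finset.sum_nonneg fun _ _ => Finset.sum_nonneg fun _ _ =>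
    mul_nonneg ENNReal.toReal_nonneg (hF.weighted_pos a _ _).le

lemma Interaction.halfSurfaceSum_mono (hF : IsDecayFunction V F) (hΦ : Φ.MemB F a) {U W : Set V}
    (h : U ⊆ W) (X Y : Finset V) :
    Φ.halfSurfaceSum F a U X Y ≤ Φ.halfSurfaceSum F a W X Y :=
  Finset.sum_le_sum fun x _ => Finset.sum_le_sum fun y _ => mul_le_mul_of_nonneg_right
    (ENNReal.toReal_mono (surfaceNorm_ne_top hΦ W X x) (Φ.surfaceNorm_mono F a h X x))
    (hF.weighted_pos a x y).le

/-- If a weight `q` is at most `∑ g y` over the points `y ∈ T` of a set, then its sum over the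
interaction terms that cross the surface of `X` is bounded by a double sum over `X` and `T`. -/
lemma Interaction.sum_surface_mul_le (hF : IsDecayFunction V F) (hΦ : Φ.MemB F a)
    {L X T : Finset V} (hT : T ⊆ L) {g : V → ℝ} (hg : ∀ y, 0 ≤ g y) {q : Finset V → ℝ}
    [DecidablePred (· ∈ surface X)]
    (hq : ∀ Z ⊆ L, q Z ≤ ∑ y ∈ T with y ∈ Z, g y) :
    ∑ Z ∈ L.powerset with Z ∈ surface X, ‖Φ.term Z‖ * q Z ≤
      ∑ x ∈ X, ∑ y ∈ T,
        (Φ.surfaceNorm F a (L : Set V) X x).toReal * weighted F a (dist x y) * g y := by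
  classical
  -- Each crossing `Z` has at least one point in `X`. Summing over all `x ∈ X ∩ Z` overcounts, but
  -- permits exchanging the sums.
  calc _ ≤ ∑ Z ∈ L.powerset with Z ∈ surface X, ∑ x ∈ X, ∑ y ∈ T,
        if x ∈ Z ∧ y ∈ Z then ‖Φ.term Z‖ * g y else 0 := by
        refine Finset.sum_le_sum fun Z hZ => ?_
        rw [Finset.mem_filter, Finset.mem_powerset] at hZ
        obtain ⟨x, hxZ, hx⟩ := hZ.2.1
        refine le_trans ?_ (Finset.single_le_sum (f := fun x => ∑ y ∈ T,
          if x ∈ Z ∧ y ∈ Z then ‖Φ.term Z‖ * g y else 0) (fun x _ =>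
            Finset.sum_nonneg fun y _ => ?_) hx)
        · refine (mul_le_mul_of_nonneg_left (hq Z hZ.1) (norm_nonneg _)).trans ?_
          simp only [hxZ, true_and]
          rw [Finset.mul_sum, Finset.sum_filter]
        · have := hg y
          split_ifs <;> positivity
    _ = ∑ x ∈ X, ∑ y ∈ T,
        (∑ Z ∈ L.powerset with Z ∈ surface X ∧ x ∈ Z ∧ y ∈ Z, ‖Φ.term Z‖) * g y := by
        rw [Finset.sum_comm]
        refine Finset.sum_congr rfl fun x _ => ?_
        rw [Finset.sum_comm]
        refine Finset.sum_congr rfl fun y _ => ?_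
        rw [Finset.sum_mul, ← Finset.sum_filter, Finset.filter_filter]
    _ ≤ _ := by
        gcongr with x hx y hy
        · exact hg y
        · exact sum_surface_le hF hΦ hx (hT hy)

/-- The indicator of meeting `Y` is at most the number of points in `Y ∩ Z`, which is the case `g =
1` above. -/
lemma Interaction.sum_surface_meets_le (hF : IsDecayFunction V F) (hΦ : Φ.MemB F a)
    {L X Y : Finset V} (hY : Y ⊆ L) [DecidablePred (· ∈ surface X)] :
    ∑ Z ∈ L.powerset with Z ∈ surface X, ‖Φ.term Z‖ * meets Y Z ≤
      Φ.halfSurfaceSum F a (L : Set V) X Y := by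
  refine (sum_surface_mul_le hF hΦ hY (g := fun _ => 1) (fun _ => zero_le_one)
    fun Z _ => ?_).trans_eq ?_
  · unfold meets
    split_ifs with h
    · exact Finset.sum_nonneg fun _ _ => zero_le_one
    · obtain ⟨y, hyZ, hyY⟩ := Finset.not_disjoint_iff.1 h
      exact Finset.single_le_sum (f := fun _ => (1 : ℝ)) (fun _ _ => zero_le_one)
        (Finset.mem_filter.2 ⟨hyY, hyZ⟩)
  · simp only [mul_one, halfSurfaceSum]

/-- The surface norms of `Z` are replaced by `‖Φ‖_a` and the sum over `Z` is enlarged to `L`, where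
the convolution property applies. The surface norm of `X` is kept, so that the same weight reappears
on the right. -/
lemma Interaction.sum_surface_halfSurfaceSum_le (hF : IsDecayFunction V F) (ha : 0 ≤ a)
    (hΦ : Φ.MemB F a) {L X Y : Finset V} [DecidablePred (· ∈ surface X)] :
    ∑ Z ∈ L.powerset with Z ∈ surface X, ‖Φ.term Z‖ * Φ.halfSurfaceSum F a (L : Set V) Z Y ≤
      (Φ.norm F a).toReal * (convConst V (weighted F a)).toReal *
        Φ.halfSurfaceSum F a (L : Set V) X Y := by
  have hw := hF.weighted_pos a
  refine (sum_surface_mul_le hF hΦ subset_rfl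
    (g := fun z => ∑ y ∈ Y, (Φ.norm F a).toReal * weighted F a (dist z y))
    (fun z => Finset.sum_nonneg fun y _ => mul_nonneg ENNReal.toReal_nonneg (hw z y).le)
    fun Z hZ => ?_).trans ?_
  · rw [Finset.filter_mem_eq_inter, Finset.inter_eq_right.2 hZ]
    exact Finset.sum_le_sum fun z _ => Finset.sum_le_sum fun y _ =>
      mul_le_mul_of_nonneg_right (surfaceNorm_toReal_le hΦ _ _ _) (hw z y).le
  · rw [halfSurfaceSum, Finset.mul_sum]
    refine Finset.sum_le_sum fun x _ => ?_
    calc _ = ∑ y ∈ Y, (Φ.surfaceNorm F a (L : Set V) X x).toReal * (Φ.norm F a).toReal *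
          ∑ z ∈ L, weighted F a (dist x z) * weighted F a (dist z y) := by
          simp only [Finset.mul_sum]
          rw [Finset.sum_comm]
          exact Finset.sum_congr rfl fun y _ => Finset.sum_congr rfl fun z _ => by ring
      _ ≤ ∑ y ∈ Y, (Φ.surfaceNorm F a (L : Set V) X x).toReal * (Φ.norm F a).toReal *
          ((convConst V (weighted F a)).toReal * weighted F a (dist x y)) := by
          gcongr with y
          exact hF.sum_convolution_le ha L x y
      _ = _ := by
          rw [Finset.mul_sum]
          exact Finset.sum_congr rfl fun y _ => by ring

/-- Each boundary point `x` contributes at most `‖Φ‖_a e^{-a d(X,Y)} ∑_y F(d(x,y))`, and the last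
sum is at most `‖F‖`. Other points contribute nothing. -/
lemma Interaction.halfSurfaceSum_le (hF : IsDecayFunction V F) (ha : 0 ≤ a) (hΦ : Φ.MemB F a)
    (U : Set V) (X Y : Finset V) :
    Φ.halfSurfaceSum F a U X Y ≤ (Φ.norm F a).toReal * (decayNorm V F).toReal *
      (boundary Φ X).ncard * Real.exp (-a * (setDist X Y).toReal) := by
  classical
  have hx : ∀ x ∈ X, ∑ y ∈ Y, (Φ.surfaceNorm F a U X x).toReal * weighted F a (dist x y) ≤
      if x ∈ boundary Φ X then (Φ.norm F a).toReal * (decayNorm V F).toReal *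
        Real.exp (-a * (setDist X Y).toReal) else 0 := by
    intro x hx
    split_ifs with hb
    · rw [← Finset.mul_sum]
      calc _ ≤ (Φ.norm F a).toReal *
            ∑ y ∈ Y, Real.exp (-a * (setDist X Y).toReal) * F (dist x y) := by
            refine mul_le_mul (surfaceNorm_toReal_le hΦ _ _ _) (Finset.sum_le_sum fun y hy => ?_)
              (Finset.sum_nonneg fun y _ => (hF.weighted_pos a x y).le) ENNReal.toReal_nonneg
            refine mul_le_mul_of_nonneg_right (Real.exp_le_exp.2 ?_) (hF.pos _ dist_nonneg).le
            have := setDist_toReal_le_dist hx hy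
            nlinarith
        _ ≤ _ := by
            rw [← Finset.mul_sum, mul_assoc, mul_comm (decayNorm V F).toReal]
            gcongr
            exact hF.sum_le_decayNorm Y x
    · simp [surfaceNorm_eq_zero_of_notMem_boundary hb]
  refine (Finset.sum_le_sum hx).trans_eq ?_
  rw [← Finset.sum_filter, Finset.sum_const, nsmul_eq_mul]
  have : (boundary Φ X).ncard = (X.filter (· ∈ boundary Φ X)).card := by
    rw [← Set.ncard_coe_finset]
    congr 1
    ext x
    simp only [Finset.coe_filter, Set.mem_ofPred_eq]
    exact ⟨fun h => ⟨h.1, h⟩, fun h => h.2⟩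
  rw [this]
  ring

lemma Interaction.halfSurfaceSum_eq_zero (hF : IsDecayFunction V F) (hΦ : Φ.MemB F a) (ha : 0 ≤ a)
    (h : (Φ.norm F a).toReal * (convConst V (weighted F a)).toReal = 0) (U : Set V)
    (X Y : Finset V) : Φ.halfSurfaceSum F a U X Y = 0 := by
  refine le_antisymm ?_ (halfSurfaceSum_nonneg hF U X Y)
  rcases mul_eq_zero.1 h with h | h
  · simpa [h] using halfSurfaceSum_le hF ha hΦ U X Y
  · cases isEmpty_or_nonempty V
    · simp [halfSurfaceSum, Finset.eq_empty_of_isEmpty X]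
    · rw [ENNReal.toReal_eq_zero_iff] at h
      exact absurd h (not_or.2 ⟨hF.convConst_weighted_ne_zero a, hF.convConst_weighted_ne_top ha⟩)

/-! ### Lieb-Robinson bounds -/

lemma norm_evolvedCommutator_le_halfSurfaceSum (hF : IsDecayFunction V F) (ha : 0 ≤ a)
    (hΦ : Φ.MemB F a) {L X Y : Finset V} (hX : X ⊆ L) (hY : Y ⊆ L) (hXY : Disjoint X Y)
    (A : LocalAlg n X) (B : LocalAlg n Y) (t : ℝ) :
    ‖evolvedCommutator Φ hX hY t A B‖ ≤
      2 * ‖A‖ * ‖B‖ / ((Φ.norm F a).toReal * (convConst V (weighted F a)).toReal) *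
        (Real.exp (2 * (Φ.norm F a).toReal * (convConst V (weighted F a)).toReal * |t|) - 1) *
          Φ.halfSurfaceSum F a (L : Set V) X Y := by
  classical
  have hκ0 : 0 ≤ (Φ.norm F a).toReal * (convConst V (weighted F a)).toReal := by positivity
  rcases hκ0.eq_or_lt with hκ | hκ
  · have hz := Interaction.halfSurfaceSum_eq_zero hF hΦ ha hκ.symm (L : Set V)
    refine (norm_evolvedCommutator_le_of_weight Φ hX hY hXY A B one_pos
      (D := fun X => Φ.halfSurfaceSum F a (L : Set V) X Y)
      (fun X _ => Interaction.sum_surface_meets_le hF hΦ hY) (fun X _ => ?_) t).trans_eq ?_ <;>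
    simp [hz]
  · refine (norm_evolvedCommutator_le_of_weight Φ hX hY hXY A B hκ
      (D := fun X => Φ.halfSurfaceSum F a (L : Set V) X Y)
      (fun X _ => Interaction.sum_surface_meets_le hF hΦ hY)
      (fun X _ => Interaction.sum_surface_halfSurfaceSum_le hF ha hΦ) t).trans_eq ?_
    rw [← mul_assoc 2]
    ring

/-- The Lieb-Robinson bound in a finite volume, in terms of the sum over the surfaces. -/
lemma norm_evolvedCommutator_le_surfaceSum (hF : IsDecayFunction V F) (ha : 0 ≤ a)
    (hΦ : Φ.MemB F a) {L X Y : Finset V} (hX : X ⊆ L) (hY : Y ⊆ L) (hXY : Disjoint X Y)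
    (A : LocalAlg n X) (B : LocalAlg n Y) (t : ℝ) :
    ‖evolvedCommutator Φ hX hY t A B‖ ≤
      2 * ‖A‖ * ‖B‖ / ((Φ.norm F a).toReal * (convConst V (weighted F a)).toReal) *
        (Real.exp (2 * (Φ.norm F a).toReal * (convConst V (weighted F a)).toReal * |t|) - 1) *
          Φ.surfaceSum F a (L : Set V) X Y := by
  rw [Interaction.surfaceSum_eq_min]
  rcases min_choice (Φ.halfSurfaceSum F a (L : Set V) X Y)
    (Φ.halfSurfaceSum F a (L : Set V) Y X) with h | h <;> rw [h]
  · exact norm_evolvedCommutator_le_halfSurfaceSum hF ha hΦ hX hY hXY A B t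
  · rw [norm_evolvedCommutator_swap, mul_right_comm 2, ← abs_neg t]
    exact norm_evolvedCommutator_le_halfSurfaceSum hF ha hΦ hY hX hXY.symm B A (-t)

lemma Interaction.surfaceSum_mono (hF : IsDecayFunction V F) (hΦ : Φ.MemB F a) {U W : Set V}
    (h : U ⊆ W) (X Y : Finset V) : Φ.surfaceSum F a U X Y ≤ Φ.surfaceSum F a W X Y := by
  simp only [surfaceSum_eq_min]
  exact min_le_min (halfSurfaceSum_mono hF hΦ h X Y) (halfSurfaceSum_mono hF hΦ h Y X)

lemma Interaction.surfaceSum_le (hF : IsDecayFunction V F) (ha : 0 ≤ a) (hΦ : Φ.MemB F a)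
    (U : Set V) (X Y : Finset V) :
    Φ.surfaceSum F a U X Y ≤ (Φ.norm F a).toReal * (decayNorm V F).toReal *
      (min (boundary Φ X).ncard (boundary Φ Y).ncard : ℕ) *
        Real.exp (-a * (setDist X Y).toReal) := by
  rw [surfaceSum_eq_min]
  rcases min_choice (boundary Φ X).ncard (boundary Φ Y).ncard with h | h <;> rw [h]
  · exact (min_le_left _ _).trans (halfSurfaceSum_le hF ha hΦ U X Y)
  · rw [setDist_comm]
    exact (min_le_right _ _).trans (halfSurfaceSum_le hF ha hΦ U Y X)

/-- The Lieb-Robinson bound outside a cone. -/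
lemma norm_evolvedCommutator_le_exp (hF : IsDecayFunction V F) (ha : 0 < a)
    (hΦ : Φ.MemB F a) {L X Y : Finset V} (hX : X ⊆ L) (hY : Y ⊆ L) (hXY : Disjoint X Y)
    (A : LocalAlg n X) (B : LocalAlg n Y) (t : ℝ) :
    ‖evolvedCommutator Φ hX hY t A B‖ ≤
      2 * ‖A‖ * ‖B‖ * (decayNorm V F).toReal / (convConst V (weighted F a)).toReal *
        (min (boundary Φ X).ncard (boundary Φ Y).ncard : ℕ) *
          Real.exp (-a * ((setDist X Y).toReal -
            2 * (Φ.norm F a).toReal * (convConst V (weighted F a)).toReal / a * |t|)) := by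
  refine (norm_evolvedCommutator_le_surfaceSum hF ha.le hΦ hX hY hXY A B t).trans ?_
  have hs := Φ.surfaceSum_le hF ha.le hΦ (L : Set V) X Y
  set N := (Φ.norm F a).toReal
  set C := (convConst V (weighted F a)).toReal
  set m : ℝ := ((min (boundary Φ X).ncard (boundary Φ Y).ncard : ℕ) : ℝ)
  have hN : 0 ≤ N := ENNReal.toReal_nonneg
  have hC : 0 ≤ C := ENNReal.toReal_nonneg
  have hm : 0 ≤ m := Nat.cast_nonneg _
  have hNF : 0 ≤ (decayNorm V F).toReal := ENNReal.toReal_nonneg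
  rcases (mul_nonneg hN hC).eq_or_lt with h0 | h0
  · rw [← h0, div_zero, zero_mul, zero_mul]
    positivity
  · have hN' : N ≠ 0 := left_ne_zero_of_mul h0.ne'
    have hC' : C ≠ 0 := right_ne_zero_of_mul h0.ne'
    have hexp : 0 ≤ Real.exp (2 * N * C * |t|) - 1 :=
      sub_nonneg.2 (Real.one_le_exp (by positivity))
    have e : -a * ((setDist X Y).toReal - 2 * N * C / a * |t|) =
        2 * N * C * |t| + -a * (setDist X Y).toReal := by
      field_simp
      ring
    rw [e, Real.exp_add]
    calc _ ≤ 2 * ‖A‖ * ‖B‖ / (N * C) * (Real.exp (2 * N * C * |t|) - 1) *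
          (N * (decayNorm V F).toReal * m * Real.exp (-a * (setDist X Y).toReal)) := by
          gcongr
      _ ≤ 2 * ‖A‖ * ‖B‖ / (N * C) * Real.exp (2 * N * C * |t|) *
          (N * (decayNorm V F).toReal * m * Real.exp (-a * (setDist X Y).toReal)) := by
          gcongr
          exact sub_le_self _ zero_le_one
      _ = _ := by
          field_simp

lemma Interaction.isVelocityBound (hF : IsDecayFunction V F) (ha : 0 < a) (hΦ : Φ.MemB F a) :
    Φ.IsVelocityBound (2 * (Φ.norm F a).toNNReal * (convConst V (weighted F a)).toNNReal /
      a.toNNReal) := by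
  refine ⟨a, ha, 2 * (decayNorm V F).toReal / (convConst V (weighted F a)).toReal,
    fun L X Y hX hY hXY A B t => ?_⟩
  refine (norm_evolvedCommutator_le_exp hF ha hΦ hX hY
    (disjoint_of_setDist_pos hXY) A B t).trans_eq ?_
  push_cast
  rw [Real.coe_toNNReal a ha.le]
  ring

lemma Interaction.velocity_le (hF : IsDecayFunction V F) (Φ : Interaction n) (ha : 0 < a) :
    Φ.velocity ≤ 2 * Φ.norm F a * convConst V (weighted F a) / ENNReal.ofReal a := by
  by_cases hΦ : Φ.MemB F a
  · refine (iInf₂_le _ (isVelocityBound hF ha hΦ)).trans_eq ?_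
    rw [ENNReal.coe_div (by simpa using ha), ENNReal.coe_mul, ENNReal.coe_mul,
      ENNReal.coe_toNNReal hΦ.ne, ENNReal.coe_toNNReal (hF.convConst_weighted_ne_top ha.le)]
    rfl
  · have hN : Φ.norm F a = ∞ := not_lt_top_iff.1 hΦ
    -- On an empty `V` the norm is an empty supremum, hence `0`. Otherwise `C_a ≠ 0`, which keeps
    -- the product `∞ * C_a` from collapsing to `0`.
    cases isEmpty_or_nonempty V
    · simp [norm] at hN
    · rw [hN, ENNReal.mul_top two_ne_zero, ENNReal.top_mul (hF.convConst_weighted_ne_zero a),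
        ENNReal.top_div_of_ne_top ENNReal.ofReal_ne_top]
      exact le_top

end Norms

end LiebRobinson

open LiebRobinson
theorem theorem2p1 {V : Type*} [DecidableEq V] [MetricSpace V] (n : V → ℕ)
    (F : ℝ → ℝ) (hF : IsDecayFunction V F) (Φ : Interaction n) :
    -- the bound in a finite volume `L`, and its uniformity in `L`
    (∀ a : ℝ, 0 ≤ a → Φ.MemB F a →
      ∀ (L X Y : Finset V) (hX : X ⊆ L) (hY : Y ⊆ L), 0 < setDist X Y →
        (∀ (A : LocalAlg n X) (B : LocalAlg n Y) (t : ℝ),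
          ‖evolvedCommutator Φ hX hY t A B‖ ≤
            2 * ‖A‖ * ‖B‖ / ((Φ.norm F a).toReal * (convConst V (weighted F a)).toReal) *
              (Real.exp (2 * (Φ.norm F a).toReal * (convConst V (weighted F a)).toReal * |t|) - 1) *
                Φ.surfaceSum F a (L : Set V) X Y) ∧
        Φ.surfaceSum F a (L : Set V) X Y ≤ Φ.surfaceSum F a Set.univ X Y) ∧
    -- the resulting exponential bound outside a cone
    (∀ a : ℝ, 0 < a → Φ.MemB F a →
      ∀ (L X Y : Finset V) (hX : X ⊆ L) (hY : Y ⊆ L), 0 < setDist X Y →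
        ∀ (A : LocalAlg n X) (B : LocalAlg n Y) (t : ℝ),
          ‖evolvedCommutator Φ hX hY t A B‖ ≤
            2 * ‖A‖ * ‖B‖ * (decayNorm V F).toReal / (convConst V (weighted F a)).toReal *
              (min (boundary Φ X).ncard (boundary Φ Y).ncard : ℕ) *
                Real.exp (-a * ((setDist X Y).toReal -
                  2 * (Φ.norm F a).toReal * (convConst V (weighted F a)).toReal / a * |t|))) ∧
    -- the bound on the velocity of propagation
    Φ.velocity ≤ ⨅ (a : ℝ) (_ : 0 < a),
      2 * Φ.norm F a * convConst V (weighted F a) / ENNReal.ofReal a := by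
  refine ⟨fun a ha hΦ L X Y hX hY hXY => ⟨fun A B t => ?_, ?_⟩,
    fun a ha hΦ L X Y hX hY hXY A B t => ?_, le_iInf₂ fun a ha => ?_⟩
  · exact norm_evolvedCommutator_le_surfaceSum hF ha hΦ hX hY (disjoint_of_setDist_pos hXY) A B t
  · exact Interaction.surfaceSum_mono hF hΦ (Set.subset_univ _) X Y
  · exact norm_evolvedCommutator_le_exp hF ha hΦ hX hY (disjoint_of_setDist_pos hXY) A B t
  · exact Φ.velocity_le hF ha
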